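/- **Notation.** $\mathbb{P}_+$ is the set of continuous bounded positive-definite functions $f:\mathbb{R}\to\mathbb{C}$ with $f(0)=1$. The Laguerre–Pólya class $\mathbb{LP}$ is the set of entire functions that are locally uniform limits on $\mathbb{C}$ of sequences of polynomials with real coefficients and only real zeros. $\mathbb{LP}_+$ is the set of $\varphi\in\mathbb{LP}$ that have only strictly negative zeros and are of the form $$\varphi(z)=K e^{az}\prod_{k}\Big(1+\frac{z}{z_k}\Big)e^{-z/z_k},\qquad K,a\in\mathbb{R},\ z_k>0,\ \sum_k z_k^{-2}<\infty,$$ where the product is infinite, finite or empty. The Lukacs class $\mathbb{D}_L$ is the set of $\mathcal{F}\in\mathbb{P}_+$ that are the restriction to $\mathbb{R}$ of an even function $\varphi\in\mathbb{LP}$ with $\varphi(0)=1$. For a real random variable $X$ write $\mathcal{F}_X(t)=\mathbb{E}[e^{itX}]$ for its characteristic function, $F_X$ for its distribution and $\mathcal{M}_X(2n)=\mathbb{E}[X^{2n}]$ for its even moments. For a real random variable $I$ and a bounded Borel function $f$ on $\mathbb{R}$, set $\Lambda_I f(t)=\int_{\mathbb{R}} f(xt)\,F_I(dx)$. **Theorem.**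 1. Let $D$ be a real random variable whose characteristic function $\mathcal{F}_D\in\mathbb{P}_+$ is even and extends to an entire function. Let $I$ be a real random variable with finite even moments of all orders such that, for every integer $n\ge 0$, $$\mathcal{M}_I(2n)\,\mathcal{M}_D(2n)=a_\varphi(n)\,G(n)\,(2n)!,$$ where $\varphi(z)=\sum_{n\ge0}a_\varphi(n)z^n\in\mathbb{LP}$ and $G\in\mathbb{LP}_+$. Then $\Lambda_I\mathcal{F}_D\in\mathbb{D}_L$. 2. Let $I_L$ be a real random variable with finite even moments of all orders, and suppose that there is $\varphi\in\mathbb{LP}_+$ with $\mathcal{M}_{I_L}(2n)=\varphi(n)$ for every integer $n\ge0$. Then $\Lambda_{I_L}(\mathbb{D}_L)\subset\mathbb{D}_L$. -/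

import Mathlib

open MeasureTheory ProbabilityTheory Filter Topology
open scoped ComplexOrder ComplexConjugate

/-- The set `P₊` of continuous bounded positive-definite functions on `ℝ`, normalized to be `1` at
the origin. (The order on `ℂ` is the one for which `0 ≤ w` means that `w` is real and
nonnegative.) -/
def posDefNormalized : Set (ℝ → ℂ) :=
  {f | Continuous f ∧ (∃ C : ℝ, ∀ t, ‖f t‖ ≤ C) ∧ f 0 = 1 ∧
    ∀ (n : ℕ) (t : Fin n → ℝ) (c : Fin n → ℂ),
      0 ≤ ∑ j, ∑ k, c j * conj (c k) * f (t j - t k)}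

/-- The Laguerre–Pólya class `LP`: locally uniform limits on `ℂ` of sequences of polynomials with
real coefficients and real zeros only. -/
def laguerrePolya : Set (ℂ → ℂ) :=
  {φ | ∃ p : ℕ → Polynomial ℝ,
    (∀ n, ∀ z : ℂ, Polynomial.aeval z (p n) = 0 → z.im = 0) ∧
    TendstoLocallyUniformly (fun n z => Polynomial.aeval z (p n)) φ atTop}

/-- The class of even functions in `LP` with value `1` at the origin. -/
def laguerrePolyaEven : Set (ℂ → ℂ) :=
  {φ | φ ∈ laguerrePolya ∧ (∀ z, φ (-z) = φ z) ∧ φ 0 = 1}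

/-- The class `LP₊`: functions in `LP` with only strictly negative zeros and of the form
`φ(z) = K e^{az} ∏ₖ (1 + z / zₖ) e^{-z / zₖ}` with `K, a` real, `zₖ > 0` and `∑ₖ zₖ⁻² < ∞`, where
the product may be finite, infinite or empty. Here `w k` stands for `1 / zₖ`, and an index with
`w k = 0` contributes the trivial factor `1`. -/
def laguerrePolyaPlus : Set (ℂ → ℂ) :=
  {φ | φ ∈ laguerrePolya ∧ (∀ z, φ z = 0 → ∃ x : ℝ, x < 0 ∧ z = x) ∧
    ∃ (K a : ℝ) (w : ℕ → ℝ), (∀ k, 0 ≤ w k) ∧ Summable (fun k => w k ^ 2) ∧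
      ∀ z : ℂ, Tendsto
        (fun n => (K : ℂ) * Complex.exp (a * z) *
          ∏ k ∈ Finset.range n, (1 + w k * z) * Complex.exp (-(w k * z)))
        atTop (𝓝 (φ z))}

/-- The Lukacs class `D_L`: functions in `P₊` that are the restriction to `ℝ` of an even function
in `LP` with value `1` at the origin. -/
def lukacsClass : Set (ℝ → ℂ) :=
  {f | f ∈ posDefNormalized ∧ ∃ φ ∈ laguerrePolyaEven, ∀ t : ℝ, f t = φ t}

/-- The Markov multiplicative operator `Λ_I f(t) = ∫ f(xt) F_I(dx)`, where `μ = F_I` is the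
distribution of the random variable `I`. -/
noncomputable def markovMul (μ : Measure ℝ) (f : ℝ → ℂ) : ℝ → ℂ :=
  fun t => ∫ x, f (x * t) ∂μ

/-! Positive definiteness survives because `markovMul` averages dilates. On even power series it
multiplies the coefficient of `t ^ (2 * n)` by the moment of order `2 * n`, so the question is
whether this preserves real zeros. In the first claim the new series is `∑ a n * G n * (-t ^ 2) ^
n`. In the second, the `k`-th coefficient of an even function is multiplied by `φ (k / 2)`.

Laguerre's theorem drives both claims: values of an `LP₊` function along an arithmetic progression
are limits of multipliers, built from geometric sequences and sequences `1 + w * k`. The latter act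
as `p ↦ p + w X p'`, which keeps roots real (`RealRooted.add_mul_X_mul_derivative`).

Passage to the limit goes through Jensen polynomials, each of which sees finitely many coefficients.
They are hyperbolic for real-rooted polynomials (`RealRooted.hyperbolic_jensen`), stay so under
coefficientwise limits (`Hyperbolic.of_tendsto`), and converge locally uniformly to the function
(`tendstoLocallyUniformly_jensen`).

In the first claim an entire characteristic function yields all moments of `D`; nonnegative
coefficients then make the Jensen roots negative, so `z ↦ -z ^ 2` pulls them back to real points. -/

/-! ### Real-rooted polynomials, Hermite–Poulain, and limits -/

/-- A complex polynomial all of whose roots are real (in particular it is nonzero). -/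
def RealRooted (p : Polynomial ℂ) : Prop := ∀ z : ℂ, p.eval z = 0 → z.im = 0

/-- A complex polynomial that is zero or has only real roots. -/
def Hyperbolic (p : Polynomial ℂ) : Prop := p = 0 ∨ RealRooted p

open Polynomial in
theorem RealRooted.ne_zero {p : ℂ[X]} (hp : RealRooted p) : p ≠ 0 := by
  rintro rfl
  simpa using hp Complex.I (by simp)

open Polynomial in
theorem RealRooted.hyperbolic {p : ℂ[X]} (hp : RealRooted p) : Hyperbolic p := Or.inr hp

theorem Complex.im_one_div_sub_ofReal (z : ℂ) (r : ℝ) :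
    (1 / (z - r)).im = -z.im / Complex.normSq (z - r) := by
  simp

-- In the partial fraction expansion of `p' / p`, each term `1 / (z - r)` with `r` real has
-- imaginary part of sign opposite to that of `z`.
open Polynomial in
theorem RealRooted.logDeriv_im_mul_im {p : ℂ[X]} (hp : RealRooted p) {z : ℂ} (hz : z.im ≠ 0) :
    (p.derivative.eval z / p.eval z).im * z.im ≤ 0 ∧
      (p.natDegree ≠ 0 → (p.derivative.eval z / p.eval z).im * z.im < 0) := by
  have hpz : p.eval z ≠ 0 := fun h => hz (hp z h)
  rw [(IsAlgClosed.splits p).eval_derivative_div_eval_of_ne_zero hpz]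
  have hreal : ∀ r ∈ p.roots, r.im = 0 := fun r hr => hp r (isRoot_of_mem_roots hr)
  have key : ∀ s : Multiset ℂ, (∀ r ∈ s, r.im = 0) →
      ((s.map fun r => 1 / (z - r)).sum).im * z.im ≤ 0 ∧
        (s ≠ 0 → ((s.map fun r => 1 / (z - r)).sum).im * z.im < 0) := by
    intro s
    induction s using Multiset.induction_on with
    | empty => simp
    | cons r s ih =>
      intro h
      have h1 := (ih fun x hx => h x (Multiset.mem_cons_of_mem hx)).1
      have hr : r = ((r.re : ℝ) : ℂ) := Complex.ext (by simp) (by simp [h r])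
      have h2 : (1 / (z - r)).im * z.im < 0 := by
        rw [hr, Complex.im_one_div_sub_ofReal]
        have : 0 < Complex.normSq (z - r.re) := by
          rw [Complex.normSq_pos]
          intro h0
          apply hz
          simpa using congrArg Complex.im h0
        have hz2 : 0 < z.im ^ 2 := by positivity
        have : 0 < z.im ^ 2 / Complex.normSq (z - r.re) := by positivity
        calc _ = -(z.im ^ 2 / Complex.normSq (z - r.re)) := by ring
          _ < 0 := by linarith
      have h3 : ((Multiset.map (fun r => 1 / (z - r)) (r ::ₘ s)).sum).im * z.im < 0 := by
        rw [Multiset.map_cons, Multiset.sum_cons, Complex.add_im, add_mul]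
        linarith
      exact ⟨h3.le, fun _ => h3⟩
  refine ⟨(key _ hreal).1, fun h => (key _ hreal).2 fun h0 => h ?_⟩
  rw [(IsAlgClosed.splits p).natDegree_eq_card_roots, h0, Multiset.card_zero]

open Polynomial in
theorem RealRooted.add_mul_X_mul_derivative {p : ℂ[X]} (hp : RealRooted p) {w : ℝ} (hw : 0 ≤ w) :
    RealRooted (p + C (w : ℂ) * (X * derivative p)) := by
  intro z hz
  by_contra him
  have hpz : p.eval z ≠ 0 := fun h => him (hp z h)
  have hs := (hp.logDeriv_im_mul_im him).1
  set s := p.derivative.eval z / p.eval z with hsdef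
  have hds : p.derivative.eval z = s * p.eval z := by rw [hsdef, div_mul_cancel₀ _ hpz]
  simp only [eval_add, eval_mul, eval_C, eval_X, hds] at hz
  have h1 : 1 + w * (z * s) = 0 := by
    apply mul_right_cancel₀ hpz
    linear_combination hz
  have hre := congrArg Complex.re h1
  have him1 := congrArg Complex.im h1
  simp at hre him1
  rcases him1 with h0 | h0
  · simp [h0] at hre
  have hw0 : 0 < w := lt_of_le_of_ne hw (by rintro rfl; simp at hre)
  have h2 : (z.re * s.re - z.im * s.im) < 0 := by
    by_contra hcon
    push Not at hcon
    nlinarith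
  have hz2 : 0 < z.im ^ 2 := by positivity
  -- By `h0` the number `z * s` is real. Then `z * s` times `z.im ^ 2` equals `-|z|² * s.im * z.im`,
  -- which is nonnegative, against `h2`.
  have h3 : z.re * s.re * z.im = - z.re ^ 2 * s.im + z.re * 0 := by linear_combination z.re * h0
  have h4 : (z.re * s.re - z.im * s.im) * z.im ^ 2 = -(z.re ^ 2 + z.im ^ 2) * (s.im * z.im) := by
    linear_combination z.im * h3
  nlinarith [mul_nonneg (by positivity : 0 ≤ z.re ^ 2 + z.im ^ 2) (neg_nonneg.2 hs)]

-- At a nonreal root `p' / p` would equal the real number `r`, but its imaginary part is nonzero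
-- unless `p` is constant. Constants may be sent to zero, hence `Hyperbolic` rather than
-- `RealRooted`.
open Polynomial in
theorem Hyperbolic.derivative_sub {p : ℂ[X]} (hp : Hyperbolic p) (r : ℝ) :
    Hyperbolic (derivative p - C (r : ℂ) * p) := by
  rcases hp with rfl | hp
  · left; simp
  by_cases hdeg : p.natDegree = 0
  · rw [natDegree_eq_zero] at hdeg
    obtain ⟨c, rfl⟩ := hdeg
    by_cases hrc : (r : ℂ) * c = 0
    · left; simp [← C_mul, hrc]
    · right
      intro z hz
      simp only [derivative_C, zero_sub, eval_neg, eval_mul, eval_C, neg_eq_zero] at hz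
      exact absurd hz hrc
  · right
    intro z hz
    by_contra him
    have hpz : p.eval z ≠ 0 := fun h => him (hp z h)
    have hs := (hp.logDeriv_im_mul_im him).2 hdeg
    simp only [eval_sub, eval_mul, eval_C, sub_eq_zero] at hz
    rw [hz, mul_div_cancel_right₀ _ hpz] at hs
    simp at hs

open Polynomial in
theorem Hyperbolic.smul {p : ℂ[X]} (hp : Hyperbolic p) (c : ℂ) : Hyperbolic (c • p) := by
  by_cases hc : c = 0
  · left; simp [hc]
  rcases hp with rfl | hp
  · left; simp
  · right
    intro z hz
    simp only [eval_smul, smul_eq_mul, mul_eq_zero, hc, false_or] at hz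
    exact hp z hz

-- Hermite–Poulain: `q(D)` factors into operators `D - r` with `r` real.
open Polynomial in
theorem RealRooted.aeval_derivative {q p : ℂ[X]} (hq : RealRooted q) (hp : Hyperbolic p) :
    Hyperbolic (aeval (derivative : ℂ[X] →ₗ[ℂ] ℂ[X]) q p) := by
  have key : ∀ s : Multiset ℂ, (∀ r ∈ s, r.im = 0) →
      Hyperbolic (aeval (derivative : ℂ[X] →ₗ[ℂ] ℂ[X]) (s.map fun r => X - C r).prod p) := by
    intro s
    induction s using Multiset.induction_on with
    | empty => simpa using hp
    | cons r s ih =>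
      intro h
      have h1 := ih fun x hx => h x (Multiset.mem_cons_of_mem hx)
      have hr : r = ((r.re : ℝ) : ℂ) := Complex.ext (by simp) (by simp [h r])
      have h2 := h1.derivative_sub r.re
      rw [← hr] at h2
      simpa [← smul_eq_C_mul] using h2
  have h := (key q.roots fun r hr => hq r (isRoot_of_mem_roots hr)).smul q.leadingCoeff
  rw [(IsAlgClosed.splits q).eq_prod_roots]
  simpa using h

-- Each factor `|x + iy - r|` with `r` real increases with `|y|`. This monotonicity characterizes
-- hyperbolicity by closed pointwise conditions.
open Polynomial in
theorem RealRooted.norm_eval_le {p : ℂ[X]} (hp : RealRooted p) (x : ℝ) {y y' : ℝ}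
    (h : |y'| ≤ |y|) : ‖p.eval ⟨x, y'⟩‖ ≤ ‖p.eval ⟨x, y⟩‖ := by
  have key : ∀ s : Multiset ℂ, (∀ r ∈ s, r.im = 0) →
      ‖(s.map fun r => (⟨x, y'⟩ : ℂ) - r).prod‖ ≤ ‖(s.map fun r => (⟨x, y⟩ : ℂ) - r).prod‖ := by
    intro s
    induction s using Multiset.induction_on with
    | empty => simp
    | cons r s ih =>
      intro hs
      have h1 := ih fun x hx => hs x (Multiset.mem_cons_of_mem hx)
      simp only [Multiset.map_cons, Multiset.prod_cons, norm_mul]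
      gcongr
      rw [Complex.norm_def, Complex.norm_def]
      apply Real.sqrt_le_sqrt
      have := sq_le_sq.2 h
      simp only [Complex.normSq_apply, Complex.sub_re, Complex.sub_im,
        hs r (Multiset.mem_cons_self r s)]
      nlinarith
  have h := key p.roots fun r hr => hp r (isRoot_of_mem_roots hr)
  rw [(IsAlgClosed.splits p).eq_prod_roots]
  simp only [eval_mul, eval_C, eval_multiset_prod, Multiset.map_map, Function.comp_def, eval_sub,
    eval_X, norm_mul]
  gcongr

-- A nonreal root would force zeros on a whole vertical segment.
open Polynomial in
theorem hyperbolic_of_norm_eval_le {p : ℂ[X]}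
    (h : ∀ x y y' : ℝ, |y'| ≤ |y| → ‖p.eval ⟨x, y'⟩‖ ≤ ‖p.eval ⟨x, y⟩‖) : Hyperbolic p := by
  by_contra hcon
  simp only [Hyperbolic, RealRooted, not_or, not_forall] at hcon
  obtain ⟨hp0, z, hz, him⟩ := hcon
  apply hp0
  apply eq_zero_of_infinite_isRoot
  have hinj : Function.Injective fun y : ℝ => (⟨z.re, y⟩ : ℂ) := fun a b hab => by
    simpa using congrArg Complex.im hab
  have hinf : (Set.Icc 0 |z.im|).Infinite := Set.Icc_infinite (abs_pos.2 him)
  refine (hinf.image hinj.injOn).mono ?_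
  rintro _ ⟨y, hy, rfl⟩
  have h1 := h z.re z.im y (by rw [abs_of_nonneg hy.1]; exact hy.2)
  rw [show (⟨z.re, z.im⟩ : ℂ) = z from rfl, hz, norm_zero] at h1
  exact norm_le_zero_iff.1 h1

-- Serves as Hurwitz's theorem, needing only pointwise convergence and no degree bound.
open Polynomial in
theorem Hyperbolic.of_tendsto {P : ℕ → ℂ[X]} {p : ℂ[X]} (hP : ∀ n, Hyperbolic (P n))
    (h : ∀ z, Tendsto (fun n => (P n).eval z) atTop (𝓝 (p.eval z))) : Hyperbolic p := by
  refine hyperbolic_of_norm_eval_le fun x y y' hy => ?_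
  refine le_of_tendsto_of_tendsto' (h _).norm (h _).norm fun n => ?_
  rcases hP n with h0 | h0
  · simp [h0]
  · exact h0.norm_eval_le x hy

/-! ### Multipliers -/

/-- The diagonal operator multiplying the `k`-th coefficient of a polynomial by `γ k`. -/
noncomputable def diagMul (γ : ℕ → ℂ) (p : Polynomial ℂ) : Polynomial ℂ :=
  p.sum fun k c => Polynomial.monomial k (γ k * c)

open Polynomial in
theorem coeff_diagMul (γ : ℕ → ℂ) (p : ℂ[X]) (k : ℕ) :
    (diagMul γ p).coeff k = γ k * p.coeff k := by
  rw [diagMul, Polynomial.sum, finsetSum_coeff]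
  simp only [coeff_monomial]
  rw [Finset.sum_ite_eq']
  split_ifs with h
  · rfl
  · rw [notMem_support_iff.1 h, mul_zero]

/-- A sequence is a multiplier if the diagonal operator it defines preserves the polynomials
with only real roots. -/
def IsMultiplier (γ : ℕ → ℂ) : Prop := ∀ p, RealRooted p → RealRooted (diagMul γ p)

theorem IsMultiplier.mul {γ δ : ℕ → ℂ} (hγ : IsMultiplier γ) (hδ : IsMultiplier δ) :
    IsMultiplier fun k => γ k * δ k := by
  intro p hp
  have : diagMul (fun k => γ k * δ k) p = diagMul γ (diagMul δ p) := by
    ext k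
    simp only [coeff_diagMul, mul_assoc]
  rw [this]
  exact hγ _ (hδ _ hp)

open Polynomial in
theorem isMultiplier_const {c : ℂ} (hc : c ≠ 0) : IsMultiplier fun _ => c := by
  intro p hp z hz
  have : diagMul (fun _ => c) p = C c * p := by
    ext k
    rw [coeff_diagMul, coeff_C_mul]
  rw [this, eval_mul, eval_C, mul_eq_zero] at hz
  exact hp z (hz.resolve_left hc)

open Polynomial in
theorem isMultiplier_pow {r : ℝ} (hr : r ≠ 0) : IsMultiplier fun k => (r : ℂ) ^ k := by
  intro p hp z hz
  have : diagMul (fun k => (r : ℂ) ^ k) p = p.comp (C (r : ℂ) * X) := by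
    ext k
    rw [coeff_diagMul, comp_C_mul_X_coeff, mul_comm]
  rw [this, eval_comp] at hz
  have := hp _ hz
  simpa [hr] using this

open Polynomial in
theorem isMultiplier_linear {w : ℝ} (hw : 0 ≤ w) : IsMultiplier fun k => 1 + (w : ℂ) * k := by
  intro p hp
  have : diagMul (fun k => 1 + (w : ℂ) * k) p = p + C (w : ℂ) * (X * derivative p) := by
    ext k
    rw [coeff_diagMul, coeff_add, coeff_C_mul]
    cases k with
    | zero => simp
    | succ k => rw [coeff_X_mul, coeff_derivative]; push_cast; ring
  rw [this]
  exact hp.add_mul_X_mul_derivative hw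

theorem isMultiplier_exp (a : ℝ) : IsMultiplier fun k => Complex.exp (a * k) := by
  have h := isMultiplier_pow (Real.exp_ne_zero a)
  convert h using 2 with k
  rw [mul_comm, Complex.exp_nat_mul, Complex.ofReal_exp]

theorem isMultiplier_laguerre {K : ℝ} (hK : K ≠ 0) (a : ℝ) {w : ℕ → ℝ} (hw : ∀ k, 0 ≤ w k)
    (n : ℕ) : IsMultiplier fun m => (K : ℂ) * Complex.exp (a * m) *
      ∏ k ∈ Finset.range n, (1 + w k * m) * Complex.exp (-(w k * m)) := by
  refine ((isMultiplier_const (Complex.ofReal_ne_zero.2 hK)).mul (isMultiplier_exp a)).mul ?_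
  induction n with
  | zero => simpa using isMultiplier_const one_ne_zero
  | succ n ih =>
    simp only [Finset.prod_range_succ]
    refine ih.mul ((isMultiplier_linear (hw n)).mul ?_)
    simpa using isMultiplier_exp (-(w n))

/-! ### Jensen polynomials and Taylor coefficients -/

/-- The `n`-th Jensen polynomial of the power series with coefficients `b`, rescaled so that these
polynomials converge to the power series. -/
noncomputable def jensen (n : ℕ) (b : ℕ → ℂ) : Polynomial ℂ :=
  ∑ k ∈ Finset.range (n + 1),
    Polynomial.C ((n.descFactorial k / n ^ k : ℝ) * b k) * Polynomial.X ^ k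

open Polynomial in
theorem eval_jensen (n : ℕ) (b : ℕ → ℂ) (z : ℂ) :
    (jensen n b).eval z =
      ∑ k ∈ Finset.range (n + 1), ((n.descFactorial k / n ^ k : ℝ) * b k) * z ^ k := by
  simp [jensen, eval_finsetSum]

-- Up to reversal and rescaling by `n`, the Jensen polynomial is `p(D) X ^ n`, which is hyperbolic
-- by Hermite–Poulain.
open Polynomial in
theorem RealRooted.hyperbolic_jensen {p : ℂ[X]} (hp : RealRooted p) {n : ℕ} (hn : n ≠ 0) :
    Hyperbolic (jensen n p.coeff) := by
  have hn' : (n : ℂ) ≠ 0 := Nat.cast_ne_zero.2 hn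
  set A := aeval (derivative : ℂ[X] →ₗ[ℂ] ℂ[X]) p (X ^ n) with hA
  have hAh : Hyperbolic A := hp.aeval_derivative <| Or.inr fun z hz => by
    simp only [eval_pow, eval_X] at hz
    simp [eq_zero_of_pow_eq_zero hz]
  have hAev : ∀ y, A.eval y =
      ∑ k ∈ Finset.range (n + 1), p.coeff k * (n.descFactorial k * y ^ (n - k)) := by
    intro y
    -- The summation range is taken long enough to exceed both the degree of `p` and `n`.
    rw [hA, aeval_eq_sum_range' (n := p.natDegree + 1 + n) (by omega), LinearMap.sum_apply,
      eval_finsetSum]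
    symm
    refine Finset.sum_subset_zero_on_sdiff (Finset.range_mono (by omega)) ?_ ?_
    · intro k hk
      simp only [Finset.mem_sdiff, Finset.mem_range, not_lt] at hk
      rw [LinearMap.smul_apply, Module.End.pow_apply, iterate_derivative_X_pow_eq_smul,
        Nat.descFactorial_of_lt (by omega)]
      simp
    · intro k hk
      rw [LinearMap.smul_apply, Module.End.pow_apply, iterate_derivative_X_pow_eq_smul]
      simp
  have hJ : ∀ z, z ≠ 0 → (jensen n p.coeff).eval z = (z / n) ^ n * A.eval (n / z) := by
    intro z hz
    rw [eval_jensen, hAev, Finset.mul_sum]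
    refine Finset.sum_congr rfl fun k hk => ?_
    have hkn : k ≤ n := by simpa [Nat.lt_succ_iff] using hk
    obtain ⟨m, rfl⟩ := Nat.exists_eq_add_of_le hkn
    rw [Nat.add_sub_cancel_left, pow_add, div_pow, div_pow, div_pow]
    push_cast at hn' ⊢
    field_simp
  rcases hAh with h0 | h0
  · left
    have : X * jensen n p.coeff = 0 := by
      refine Polynomial.funext fun z => ?_
      by_cases hz : z = 0
      · simp [hz]
      · simp [hJ z hz, h0]
    exact (mul_eq_zero.1 this).resolve_left X_ne_zero
  · right
    intro z hz
    by_cases hz0 : z = 0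
    · simp [hz0]
    rw [hJ z hz0, mul_eq_zero] at hz
    have h1 := h0 _ (hz.resolve_left (pow_ne_zero _ (div_ne_zero hz0 hn')))
    rw [Complex.div_im] at h1
    simpa [hn, hz0] using h1

theorem hasFPowerSeriesAt_zero_of_hasSum {a : ℕ → ℂ} {φ : ℂ → ℂ}
    (h : ∀ z, HasSum (fun n => a n * z ^ n) (φ z)) :
    HasFPowerSeriesAt φ (FormalMultilinearSeries.ofScalars ℂ a) 0 := by
  rw [hasFPowerSeriesAt_iff]
  refine Eventually.of_forall fun z => ?_
  simpa [FormalMultilinearSeries.coeff_ofScalars, mul_comm] using h z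

theorem eq_iteratedDeriv_of_hasSum {a : ℕ → ℂ} {φ : ℂ → ℂ}
    (h : ∀ z, HasSum (fun n => a n * z ^ n) (φ z)) (k : ℕ) :
    a k = iteratedDeriv k φ 0 / k.factorial := by
  have h1 := hasFPowerSeriesAt_zero_of_hasSum h
  have h2 := h1.analyticAt.hasFPowerSeriesAt
  have h3 := congrArg (fun p => FormalMultilinearSeries.coeff p k)
    (h1.eq_formalMultilinearSeries h2)
  simpa only [FormalMultilinearSeries.coeff_ofScalars] using h3

open Polynomial in
theorem hasSum_aeval (p : ℝ[X]) (z : ℂ) :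
    HasSum (fun k => (p.coeff k : ℂ) * z ^ k) (aeval z p) := by
  rw [aeval_eq_sum_range]
  simp only [Complex.real_smul]
  refine hasSum_sum_of_ne_finset_zero fun k hk => ?_
  rw [coeff_eq_zero_of_natDegree_lt (by simpa [Nat.lt_succ_iff] using hk)]
  simp

theorem TendstoLocallyUniformly.iteratedDeriv {F : ℕ → ℂ → ℂ} {f : ℂ → ℂ}
    (h : TendstoLocallyUniformly F f atTop) (hF : ∀ n, Differentiable ℂ (F n)) (k : ℕ) :
    TendstoLocallyUniformly (fun n => iteratedDeriv k (F n)) (iteratedDeriv k f) atTop := by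
  induction k generalizing F f with
  | zero => simpa using h
  | succ k ih =>
    simp only [iteratedDeriv_succ']
    refine ih ?_ fun n => (hF n).deriv
    rw [← tendstoLocallyUniformlyOn_univ] at h ⊢
    exact h.deriv (Eventually.of_forall fun n => (hF n).differentiableOn) isOpen_univ

-- Taylor coefficients are derivatives at `0`, which pass to locally uniform limits.
open Polynomial in
theorem tendsto_coeff_of_tendstoLocallyUniformly {p : ℕ → ℝ[X]} {φ : ℂ → ℂ} {a : ℕ → ℂ}
    (hp : TendstoLocallyUniformly (fun n z => aeval z (p n)) φ atTop)
    (ha : ∀ z, HasSum (fun n => a n * z ^ n) (φ z)) (k : ℕ) :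
    Tendsto (fun m => ((p m).coeff k : ℂ)) atTop (𝓝 (a k)) := by
  have h := (tendstoLocallyUniformlyOn_univ.2
    (hp.iteratedDeriv (fun n => (p n).differentiable_aeval) k)).tendsto_at (Set.mem_univ 0)
  rw [eq_iteratedDeriv_of_hasSum ha]
  refine (h.div_const _).congr fun m => ?_
  rw [eq_iteratedDeriv_of_hasSum (hasSum_aeval (p m))]

theorem differentiable_of_mem_laguerrePolya {φ : ℂ → ℂ} (hφ : φ ∈ laguerrePolya) :
    Differentiable ℂ φ := by
  obtain ⟨p, -, hp⟩ := hφ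
  rw [← tendstoLocallyUniformlyOn_univ] at hp
  exact differentiableOn_univ.1 (hp.differentiableOn
    (Eventually.of_forall fun n => (p n).differentiable_aeval.differentiableOn) isOpen_univ)

theorem Differentiable.hasSum_iteratedDeriv {f : ℂ → ℂ} (hf : Differentiable ℂ f) (z : ℂ) :
    HasSum (fun k => iteratedDeriv k f 0 / k.factorial * z ^ k) (f z) := by
  convert! Complex.hasSum_taylorSeries_of_entire hf 0 z using 2 with k
  simp only [sub_zero, smul_eq_mul]
  ring

theorem exists_real_coeff_of_mem_laguerrePolya {φ : ℂ → ℂ} (hφ : φ ∈ laguerrePolya) :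
    ∃ c : ℕ → ℝ, ∀ z, HasSum (fun k => (c k : ℂ) * z ^ k) (φ z) := by
  have h := (differentiable_of_mem_laguerrePolya hφ).hasSum_iteratedDeriv
  obtain ⟨p, -, hp⟩ := hφ
  have hreal : ∀ k : ℕ, ((iteratedDeriv k φ 0 / k.factorial).re : ℂ) =
      iteratedDeriv k φ 0 / k.factorial := by
    intro k
    have h1 := tendsto_coeff_of_tendstoLocallyUniformly hp h k
    refine Complex.ext (by simp) ?_
    have h2 : Tendsto (fun _ : ℕ => (0 : ℝ)) atTop
        (𝓝 (iteratedDeriv k φ 0 / k.factorial).im) := by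
      simpa [Function.comp_def] using (Complex.continuous_im.tendsto _).comp h1
    rw [Complex.ofReal_im]
    exact tendsto_nhds_unique tendsto_const_nhds h2
  exact ⟨fun k => (iteratedDeriv k φ 0 / k.factorial).re, fun z => by simpa only [hreal] using h z⟩

theorem hyperbolic_jensen_of_tendsto {n : ℕ} {B : ℕ → ℕ → ℂ} {b : ℕ → ℂ}
    (hB : ∀ m, Hyperbolic (jensen n (B m))) (h : ∀ k, Tendsto (fun m => B m k) atTop (𝓝 (b k))) :
    Hyperbolic (jensen n b) := by
  refine Hyperbolic.of_tendsto hB fun z => ?_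
  simp only [eval_jensen]
  exact tendsto_finsetSum _ fun k _ => ((h k).const_mul _).mul_const _

open Polynomial in
/-- The Jensen polynomials of a Laguerre–Pólya function whose Taylor coefficients have been
multiplied by a limit of multipliers have only real roots, unless they vanish. -/
theorem hyperbolic_jensen_mul {φ : ℂ → ℂ} (hφ : φ ∈ laguerrePolya) {a : ℕ → ℂ}
    (ha : ∀ z, HasSum (fun n => a n * z ^ n) (φ z)) {Γ : ℕ → ℕ → ℂ} {γ : ℕ → ℂ}
    (hΓ : ∀ N, IsMultiplier (Γ N)) (h : ∀ k, Tendsto (fun N => Γ N k) atTop (𝓝 (γ k)))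
    {n : ℕ} (hn : n ≠ 0) : Hyperbolic (jensen n fun k => a k * γ k) := by
  obtain ⟨p, hroots, hp⟩ := hφ
  -- Two successive limits: in the multiplier (`N`), and for fixed `N` in the polynomials
  -- approximating `φ` (`m`).
  refine hyperbolic_jensen_of_tendsto (B := fun N k => a k * Γ N k) (fun N => ?_)
    fun k => (h k).const_mul _
  refine hyperbolic_jensen_of_tendsto
    (B := fun m k => (diagMul (Γ N) ((p m).map (algebraMap ℝ ℂ))).coeff k) (fun m => ?_) fun k => ?_
  · refine (hΓ N _ fun z hz => hroots m z ?_).hyperbolic_jensen hn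
    rwa [eval_map_algebraMap] at hz
  · simp only [coeff_diagMul, coeff_map, mul_comm (Γ N k)]
    exact (tendsto_coeff_of_tendstoLocallyUniformly hp ha k).mul_const _

/-! ### From Jensen polynomials back to the Laguerre–Pólya class -/

theorem tendsto_descFactorial_div_pow (k : ℕ) :
    Tendsto (fun n : ℕ => (n.descFactorial k / n ^ k : ℝ)) atTop (𝓝 1) := by
  induction k with
  | zero => simp
  | succ k ih =>
    have h1 : Tendsto (fun n : ℕ => 1 - (k : ℝ) / n) atTop (𝓝 1) := by
      simpa using (tendsto_const_div_atTop_nhds_zero_nat (k : ℝ)).const_sub 1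
    have h2 := h1.mul ih
    rw [one_mul] at h2
    refine h2.congr' ?_
    filter_upwards [eventually_gt_atTop k] with n hn
    have hn0 : (n : ℝ) ≠ 0 := Nat.cast_ne_zero.2 (by omega)
    rw [Nat.descFactorial_succ, Nat.cast_mul, Nat.cast_sub hn.le]
    field_simp
    ring

theorem descFactorial_div_pow_le_one (n k : ℕ) : (n.descFactorial k / n ^ k : ℝ) ≤ 1 :=
  div_le_one_of_le₀ (by exact_mod_cast n.descFactorial_le_pow k) (by positivity)

/-- The error series carries factors in `[0, 1]` tending to `0`, so dominated convergence at a
radius `R` bounding the compact set gives a uniform estimate. -/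
theorem tendstoLocallyUniformly_jensen {b : ℕ → ℂ} {f : ℂ → ℂ}
    (hf : ∀ z, HasSum (fun n => b n * z ^ n) (f z)) :
    TendstoLocallyUniformly (fun n z => (jensen n b).eval z) f atTop := by
  have hev : ∀ (n : ℕ) z, HasSum (fun k => (n.descFactorial k / n ^ k : ℝ) * b k * z ^ k)
      ((jensen n b).eval z) := by
    intro n z
    rw [eval_jensen]
    refine hasSum_sum_of_ne_finset_zero fun k hk => ?_
    rw [Nat.descFactorial_of_lt (by simpa using hk)]
    simp
  have hdiff : ∀ (n : ℕ) z, HasSum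
      (fun k => ((1 - n.descFactorial k / n ^ k : ℝ) : ℂ) * (b k * z ^ k))
      (f z - (jensen n b).eval z) := by
    intro n z
    convert! (hf z).sub (hev n z) using 2 with k
    push_cast
    ring
  rw [tendstoLocallyUniformly_iff_forall_isCompact]
  intro K hK
  obtain ⟨R, hR⟩ := hK.isBounded.exists_norm_le
  have hsum : Summable fun k => ‖b k * (R : ℂ) ^ k‖ := (hf R).summable.norm
  have hc : ∀ n k : ℕ, |(1 - n.descFactorial k / n ^ k : ℝ)| ≤ 1 := fun n k => by
    rw [abs_le]
    have := descFactorial_div_pow_le_one n k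
    have : (0 : ℝ) ≤ n.descFactorial k / n ^ k := by positivity
    constructor <;> linarith
  have hdom : ∀ n k : ℕ, ‖|(1 - n.descFactorial k / n ^ k : ℝ)| * ‖b k * (R : ℂ) ^ k‖‖ ≤
      ‖b k * (R : ℂ) ^ k‖ := fun n k => by
    rw [Real.norm_of_nonneg (by positivity)]
    exact mul_le_of_le_one_left (norm_nonneg _) (hc n k)
  have hlim : Tendsto (fun n : ℕ => ∑' k : ℕ,
      |(1 - n.descFactorial k / n ^ k : ℝ)| * ‖b k * (R : ℂ) ^ k‖) atTop (𝓝 0) := by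
    have := tendsto_tsum_of_dominated_convergence (𝓕 := atTop)
      (f := fun (n k : ℕ) => |(1 - n.descFactorial k / n ^ k : ℝ)| * ‖b k * (R : ℂ) ^ k‖)
      (g := fun _ => 0) hsum (fun k => ?_) (Eventually.of_forall fun n k => hdom n k)
    · simpa using this
    · have h1 := ((tendsto_descFactorial_div_pow k).const_sub 1).abs.mul_const ‖b k * (R : ℂ) ^ k‖
      simpa using h1
  rw [Metric.tendstoUniformlyOn_iff]
  intro ε hε
  filter_upwards [hlim.eventually (gt_mem_nhds hε)] with n hn z hz
  rw [dist_eq_norm]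
  refine lt_of_le_of_lt ?_ hn
  have hs : Summable fun k : ℕ => |(1 - n.descFactorial k / n ^ k : ℝ)| * ‖b k * (R : ℂ) ^ k‖ :=
    Summable.of_norm_bounded hsum (hdom n)
  rw [← (hdiff n z).tsum_eq]
  refine tsum_of_norm_bounded hs.hasSum fun k => ?_
  rw [norm_mul, Complex.norm_real, Real.norm_eq_abs, norm_mul, norm_mul, norm_pow, norm_pow]
  have := (hR z hz).trans (le_abs_self R)
  rw [Complex.norm_real, Real.norm_eq_abs]
  gcongr

/-- The `n`-th Jensen polynomial as a real polynomial. -/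
noncomputable def jensenReal (n : ℕ) (b : ℕ → ℝ) : Polynomial ℝ :=
  ∑ k ∈ Finset.range (n + 1), Polynomial.C (n.descFactorial k / n ^ k * b k) * Polynomial.X ^ k

open Polynomial in
theorem aeval_jensenReal (n : ℕ) (b : ℕ → ℝ) (z : ℂ) :
    aeval z (jensenReal n b) = (jensen n fun k => (b k : ℂ)).eval z := by
  simp [jensenReal, eval_jensen]

theorem realRooted_jensen {n : ℕ} {b : ℕ → ℂ} (h : Hyperbolic (jensen n b)) (hb : b 0 ≠ 0) :
    RealRooted (jensen n b) := by
  refine h.resolve_left fun h0 => hb ?_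
  have := eval_jensen n b 0
  rw [h0, Finset.sum_range_succ'] at this
  simpa using this.symm

theorem mem_laguerrePolya_of_hyperbolic_jensen {b : ℕ → ℝ} {f : ℂ → ℂ}
    (hf : ∀ z, HasSum (fun n => (b n : ℂ) * z ^ n) (f z)) (hb : b 0 ≠ 0)
    (h : ∀ n ≠ 0, Hyperbolic (jensen n fun k => (b k : ℂ))) : f ∈ laguerrePolya := by
  refine ⟨fun n => jensenReal (n + 1) b, fun n z hz => ?_, ?_⟩
  · rw [aeval_jensenReal] at hz
    exact realRooted_jensen (h _ n.succ_ne_zero) (Complex.ofReal_ne_zero.2 hb) z hz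
  · simp only [aeval_jensenReal]
    have := tendstoLocallyUniformly_jensen hf
    intro u hu x
    obtain ⟨t, ht, h1⟩ := this u hu x
    exact ⟨t, ht, (tendsto_add_atTop_nat 1).eventually h1⟩

-- Nonnegative coefficients with `b 0 > 0` exclude roots in `[0, ∞)`; hence `-z ^ 2` is a negative
-- real at a zero, and `z` is real.
open Polynomial in
theorem comp_neg_sq_mem_laguerrePolya {b : ℕ → ℝ} {f : ℂ → ℂ}
    (hf : ∀ z, HasSum (fun n => (b n : ℂ) * z ^ n) (f z)) (hb : b 0 ≠ 0) (hnonneg : ∀ k, 0 ≤ b k)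
    (h : ∀ n ≠ 0, Hyperbolic (jensen n fun k => (b k : ℂ))) :
    (fun z => f (-z ^ 2)) ∈ laguerrePolya := by
  refine ⟨fun n => (jensenReal (n + 1) b).comp (-X ^ 2), fun n z hz => ?_, ?_⟩
  · rw [aeval_comp, aeval_jensenReal] at hz
    set u : ℂ := aeval z (-X ^ 2 : ℝ[X]) with hu
    have hu' : u = -z ^ 2 := by simp [hu]
    have him : u.im = 0 :=
      realRooted_jensen (h _ n.succ_ne_zero) (Complex.ofReal_ne_zero.2 hb) _ hz
    have hneg : u.re < 0 := by
      by_contra hcon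
      push Not at hcon
      have hue : u = (u.re : ℂ) := Complex.ext (by simp) (by simp [him])
      rw [eval_jensen, hue] at hz
      have hz' : ∑ k ∈ Finset.range (n + 1 + 1),
          ((n + 1).descFactorial k / (n + 1 : ℕ) ^ k * b k) * u.re ^ k = 0 := by
        exact_mod_cast hz
      rw [Finset.sum_range_succ'] at hz'
      have h1 : 0 ≤ ∑ k ∈ Finset.range (n + 1),
          ((n + 1).descFactorial (k + 1) / (n + 1 : ℕ) ^ (k + 1) * b (k + 1)) * u.re ^ (k + 1) :=
        Finset.sum_nonneg fun k _ => mul_nonneg (mul_nonneg (by positivity) (hnonneg _))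
          (by positivity)
      have h2 : 0 < b 0 := lt_of_le_of_ne (hnonneg 0) hb.symm
      simp only [Nat.descFactorial_zero, pow_zero, Nat.cast_one, div_one, one_mul, mul_one] at hz'
      linarith
    rw [hu'] at him hneg
    simp only [pow_two, Complex.neg_im, Complex.neg_re, Complex.mul_im, Complex.mul_re] at him hneg
    have h3 : z.re * z.im = 0 := by linarith
    rcases mul_eq_zero.1 h3 with h4 | h4
    · rw [h4] at hneg
      nlinarith [mul_self_nonneg z.im]
    · exact h4
  · have h1 : TendstoLocallyUniformly
        (fun n z => aeval z (jensenReal (n + 1) b)) f atTop := by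
      simp only [aeval_jensenReal]
      intro u hu x
      obtain ⟨t, ht, h1⟩ := tendstoLocallyUniformly_jensen hf u hu x
      exact ⟨t, ht, (tendsto_add_atTop_nat 1).eventually h1⟩
    have h2 := h1.comp (fun z : ℂ => -z ^ 2) (by fun_prop)
    simpa [aeval_comp, Function.comp_def] using h2

/-! ### The Markov operator on positive-definite functions and power series -/

theorem markovMul_mem_posDefNormalized (μ : Measure ℝ) [IsProbabilityMeasure μ] {f : ℝ → ℂ}
    (hf : f ∈ posDefNormalized) : markovMul μ f ∈ posDefNormalized := by
  obtain ⟨hcont, ⟨C, hC⟩, h0, hpos⟩ := hf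
  have hint : ∀ t : ℝ, Integrable (fun x => f (x * t)) μ := fun t =>
    Integrable.of_bound (by fun_prop) C (Eventually.of_forall fun x => hC _)
  refine ⟨?_, ⟨C, fun t => ?_⟩, ?_, fun n t c => ?_⟩
  · refine continuous_of_dominated (bound := fun _ => C) (fun t => (hint t).aestronglyMeasurable)
      (fun t => Eventually.of_forall fun x => hC _) (integrable_const _)
      (Eventually.of_forall fun x => by fun_prop)
  · simpa [markovMul] using norm_integral_le_of_norm_le_const (μ := μ)
      (Eventually.of_forall fun x => hC (x * t))
  · simp [markovMul, h0]
  · have h1 : ∑ j, ∑ k, c j * conj (c k) * markovMul μ f (t j - t k) =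
        ∫ x, ∑ j, ∑ k, c j * conj (c k) * f (x * t j - x * t k) ∂μ := by
      simp only [markovMul, ← mul_sub]
      rw [integral_finsetSum _ fun j _ => integrable_finsetSum _ fun k _ => (hint _).const_mul _]
      refine Finset.sum_congr rfl fun j _ => ?_
      rw [integral_finsetSum _ fun k _ => (hint _).const_mul _]
      exact Finset.sum_congr rfl fun k _ => (integral_const_mul _ _).symm
    rw [h1]
    exact integral_nonneg fun x => hpos n (fun j => x * t j) c

theorem hasSum_markovMul (μ : Measure ℝ) {c : ℕ → ℂ} {f : ℝ → ℂ}
    (hf : ∀ x : ℝ, HasSum (fun n => c n * (x : ℂ) ^ (2 * n)) (f x))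
    (hint : ∀ n : ℕ, Integrable (fun x : ℝ => x ^ (2 * n)) μ) (t : ℝ)
    (hs : Summable fun n => ‖c n‖ * (∫ x, x ^ (2 * n) ∂μ) * t ^ (2 * n)) :
    HasSum (fun n => c n * ((∫ x, x ^ (2 * n) ∂μ : ℝ) : ℂ) * (t : ℂ) ^ (2 * n))
      (markovMul μ f t) := by
  have h := hasSum_integral_of_summable_integral_norm (μ := μ)
    (F := fun n (x : ℝ) => c n * ((x * t : ℝ) : ℂ) ^ (2 * n)) (fun n => ?_) ?_
  · have h1 : markovMul μ f t = ∫ x, ∑' n, c n * ((x * t : ℝ) : ℂ) ^ (2 * n) ∂μ := by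
      refine integral_congr_ae (Eventually.of_forall fun x => ?_)
      exact (hf (x * t)).tsum_eq.symm
    rw [h1]
    convert! h using 2 with n
    rw [← integral_complex_ofReal, mul_assoc, ← integral_mul_const, ← integral_const_mul]
    refine integral_congr_ae (Eventually.of_forall fun x => ?_)
    push_cast
    ring
  · have h1 : Integrable (fun x : ℝ => c n * ((x ^ (2 * n) * t ^ (2 * n) : ℝ) : ℂ)) μ :=
      (((hint n).mul_const _).ofReal).const_mul _
    refine h1.congr (Eventually.of_forall fun x => ?_)
    push_cast
    ring
  · refine hs.congr fun n => ?_
    rw [mul_assoc, ← integral_mul_const, ← integral_const_mul]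
    refine integral_congr_ae (Eventually.of_forall fun x => ?_)
    have : 0 ≤ (x * t) ^ (2 * n) := (even_two_mul n).pow_nonneg _
    simp only [norm_mul, ← Complex.ofReal_pow, Complex.norm_real, Real.norm_eq_abs,
      abs_of_nonneg this]
    rw [mul_pow]

/-! ### Moments from an entire characteristic function -/

/-- The second difference vanishes to order two at `0`; dividing twice with `dslope` leaves a
function bounded on `[0, 1]`. -/
theorem exists_norm_second_difference_le {E : ℂ → ℂ} (hE : Differentiable ℂ E) :
    ∃ C : ℝ, ∀ h : ℝ, h ∈ Set.Icc (0 : ℝ) 1 → ‖E h + E (-h) - 2 * E 0‖ ≤ C * h ^ 2 := by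
  set g : ℂ → ℂ := fun z => E z + E (-z) - 2 * E 0 with hg
  have hgd : Differentiable ℂ g := by
    have : Differentiable ℂ fun z => E (-z) := hE.comp differentiable_neg
    exact (hE.add this).sub_const _
  have hg0 : g 0 = 0 := by simp only [hg, neg_zero]; ring
  have hg' : deriv g 0 = 0 := by
    have h1 : HasDerivAt g (deriv E 0 + deriv E (-0) * -1) 0 :=
      (hE.differentiableAt.hasDerivAt.add
        (HasDerivAt.comp (0 : ℂ) hE.differentiableAt.hasDerivAt (hasDerivAt_neg 0))).sub_const _
    rw [h1.deriv]
    simp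
  have hd : ∀ {u : ℂ → ℂ}, Differentiable ℂ u → Differentiable ℂ (dslope u 0) := fun hu => by
    rw [← differentiableOn_univ] at hu ⊢
    exact (Complex.differentiableOn_dslope univ_mem).2 hu
  set k := dslope (dslope g 0) 0
  have hk : Continuous fun h : ℝ => k h := (hd (hd hgd)).continuous.comp Complex.continuous_ofReal
  obtain ⟨C, hC⟩ := isCompact_Icc.exists_bound_of_continuousOn (s := Set.Icc (0 : ℝ) 1)
    hk.continuousOn
  refine ⟨C, fun h hh => ?_⟩
  have e1 : g h = h * dslope g 0 h := by
    have := sub_smul_dslope g 0 (h : ℂ)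
    simpa [hg0] using this.symm
  have e2 : dslope g 0 h = h * k h := by
    have := sub_smul_dslope (dslope g 0) 0 (h : ℂ)
    simpa [hg'] using this.symm
  change ‖g h‖ ≤ _
  rw [e1, e2, norm_mul, norm_mul, Complex.norm_real, Real.norm_eq_abs, abs_of_nonneg hh.1]
  nlinarith [hC h hh, sq_nonneg h]

theorem re_charFun (μ : Measure ℝ) [IsFiniteMeasure μ] (t : ℝ) :
    (charFun μ t).re = ∫ x, Real.cos (t * x) ∂μ := by
  have hint : Integrable (fun x : ℝ => Complex.exp (t * x * Complex.I)) μ :=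
    Integrable.of_bound (by fun_prop) 1 (Eventually.of_forall fun x => by
      rw [← Complex.ofReal_mul, Complex.norm_exp_ofReal_mul_I])
  rw [charFun_apply_real, ← Complex.reCLM_apply, ← Complex.reCLM.integral_comp_comm hint]
  refine integral_congr_ae (Eventually.of_forall fun x => ?_)
  simp only [Complex.reCLM_apply]
  rw [← Complex.ofReal_mul, Complex.exp_ofReal_mul_I_re]

/-- The second difference of `charFun μ` is `-2 ∫ (1 - cos (s x))`, so this integral is `O(s ^ 2)`.
Since `1 - cos u ≥ 2 u ^ 2 / π ^ 2` for `|u| ≤ π`, taking `s` inverse to the truncation level bounds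
the truncated second moments uniformly. -/
theorem integrable_sq_of_charFun_eq_entire (μ : Measure ℝ) [IsFiniteMeasure μ] {E : ℂ → ℂ}
    (hE : Differentiable ℂ E) (h : ∀ t : ℝ, charFun μ t = E t) :
    Integrable (fun x : ℝ => x ^ 2) μ := by
  obtain ⟨C, hC⟩ := exists_norm_second_difference_le hE
  have hcosint : ∀ s : ℝ, Integrable (fun x : ℝ => 1 - Real.cos (s * x)) μ := fun s =>
    Integrable.of_bound (by fun_prop) 2 (Eventually.of_forall fun x => by
      rw [Real.norm_eq_abs, abs_le]
      constructor <;> linarith [Real.neg_one_le_cos (s * x), Real.cos_le_one (s * x)])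
  have hcos : ∀ s ∈ Set.Icc (0 : ℝ) 1, ∫ x, (1 - Real.cos (s * x)) ∂μ ≤ C / 2 * s ^ 2 := by
    intro s hs
    have h1 := hC s hs
    rw [← Complex.ofReal_neg, ← Complex.ofReal_zero, ← h, ← h, ← h, charFun_neg] at h1
    have h2 := (Complex.abs_re_le_norm _).trans h1
    simp only [Complex.sub_re, Complex.add_re, Complex.conj_re, Complex.mul_re, re_charFun,
      Complex.re_ofNat, Complex.im_ofNat, zero_mul, sub_zero, Real.cos_zero] at h2
    have h3 := (abs_le.1 h2).1
    have hc : Integrable (fun x : ℝ => Real.cos (s * x)) μ :=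
      Integrable.of_bound (by fun_prop) 1
        (Eventually.of_forall fun x => by simpa using Real.abs_cos_le_one _)
    rw [integral_sub (integrable_const _) hc]
    linarith
  have hcover : AECover μ atTop fun n : ℕ => Set.Icc (-((n : ℝ) + 1)) ((n : ℝ) + 1) :=
    aecover_Icc (tendsto_neg_atTop_atBot.comp
      (tendsto_atTop_add_const_right _ _ tendsto_natCast_atTop_atTop))
      (tendsto_atTop_add_const_right _ _ tendsto_natCast_atTop_atTop)
  refine hcover.integrable_of_integral_norm_bounded (Real.pi ^ 2 / 2 * (C / 2)) (fun n => ?_)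
    (Eventually.of_forall fun n => ?_)
  · exact (by fun_prop : Continuous fun x : ℝ => x ^ 2).continuousOn.integrableOn_compact
      isCompact_Icc
  · have hn : (0 : ℝ) < n + 1 := by positivity
    set s : ℝ := 1 / (n + 1) with hs
    have hsn : s * (n + 1) = 1 := by rw [hs]; field_simp
    have hs0 : 0 < s := by positivity
    have hs1 : s ≤ 1 := by rw [hs, div_le_one hn]; linarith [(n.cast_nonneg : (0 : ℝ) ≤ n)]
    have hpt : ∀ x ∈ Set.Icc (-((n : ℝ) + 1)) ((n : ℝ) + 1),
        ‖x ^ 2‖ ≤ Real.pi ^ 2 / 2 * (n + 1) ^ 2 * (1 - Real.cos (s * x)) := by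
      intro x hx
      have habs : |s * x| ≤ Real.pi := by
        rw [abs_mul, abs_of_pos hs0]
        calc s * |x| ≤ s * (n + 1) := by gcongr; exact abs_le.2 hx
          _ = 1 := hsn
          _ ≤ Real.pi := by linarith [Real.pi_gt_three]
      have h1 := Real.cos_le_one_sub_mul_cos_sq habs
      rw [Real.norm_of_nonneg (sq_nonneg x)]
      have h2 : x ^ 2 = Real.pi ^ 2 / 2 * (n + 1) ^ 2 * (2 / Real.pi ^ 2 * (s * x) ^ 2) := by
        have : x ^ 2 = (s * (n + 1)) ^ 2 * x ^ 2 := by rw [hsn]; ring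
        rw [this]
        field_simp
      rw [h2]
      gcongr
      linarith
    calc ∫ x in Set.Icc (-((n : ℝ) + 1)) ((n : ℝ) + 1), ‖x ^ 2‖ ∂μ
        ≤ ∫ x in Set.Icc (-((n : ℝ) + 1)) ((n : ℝ) + 1),
            Real.pi ^ 2 / 2 * (n + 1) ^ 2 * (1 - Real.cos (s * x)) ∂μ := by
          refine setIntegral_mono_on ?_ ((hcosint s).const_mul _).integrableOn measurableSet_Icc hpt
          exact (by fun_prop : Continuous fun x : ℝ => ‖x ^ 2‖).continuousOn.integrableOn_compact
            isCompact_Icc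
      _ ≤ ∫ x, Real.pi ^ 2 / 2 * (n + 1) ^ 2 * (1 - Real.cos (s * x)) ∂μ := by
          refine setIntegral_le_integral ((hcosint s).const_mul _) (Eventually.of_forall fun x => ?_)
          have := Real.cos_le_one (s * x)
          exact mul_nonneg (by positivity) (by linarith)
      _ = Real.pi ^ 2 / 2 * (n + 1) ^ 2 * ∫ x, (1 - Real.cos (s * x)) ∂μ := integral_const_mul _ _
      _ ≤ Real.pi ^ 2 / 2 * (n + 1) ^ 2 * (C / 2 * s ^ 2) := by
          gcongr
          exact hcos s ⟨hs0.le, hs1⟩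
      _ = Real.pi ^ 2 / 2 * (C / 2) * (s * (n + 1)) ^ 2 := by ring
      _ = Real.pi ^ 2 / 2 * (C / 2) := by rw [hsn]; ring

theorem iteratedDeriv_comp_ofReal {E : ℂ → ℂ} (hE : Differentiable ℂ E) (k : ℕ) (t : ℝ) :
    iteratedDeriv k (fun s : ℝ => E s) t = iteratedDeriv k E t := by
  induction k generalizing E with
  | zero => simp
  | succ k ih =>
    rw [iteratedDeriv_succ', iteratedDeriv_succ', ← ih hE.deriv]
    congr 1
    ext s
    exact (hE.differentiableAt.hasDerivAt (x := (s : ℂ))).comp_ofReal.deriv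

theorem Differentiable.iteratedDeriv_complex {E : ℂ → ℂ} (hE : Differentiable ℂ E) (k : ℕ) :
    Differentiable ℂ (iteratedDeriv k E) :=
  (hE.contDiff (n := ⊤)).differentiable_iteratedDeriv k (by exact_mod_cast WithTop.coe_lt_top _)

/-- A finite measure whose characteristic function is the restriction of an entire function has
finite even moments of all orders. -/
theorem integrable_pow_of_charFun_eq_entire (n : ℕ) (μ : Measure ℝ) [IsFiniteMeasure μ] {E : ℂ → ℂ}
    (hE : Differentiable ℂ E) (h : ∀ t : ℝ, charFun μ t = E t) :
    Integrable (fun x : ℝ => x ^ (2 * n)) μ := by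
  induction n generalizing μ E with
  | zero => simp
  | succ n ih =>
    have h2 := integrable_sq_of_charFun_eq_entire μ hE h
    have hmem : MemLp id 2 μ := (memLp_two_iff_integrable_sq (by fun_prop)).2 h2
    have hmeas : Measurable fun x : ℝ => (x ^ 2).toNNReal := by fun_prop
    -- Reweighting by `x ^ 2` gives a finite measure with characteristic function `-E''`, again
    -- entire, so the induction hypothesis applies to it.
    set ν := μ.withDensity fun x => ((x ^ 2).toNNReal : ENNReal) with hν
    have hfin : IsFiniteMeasure ν := isFiniteMeasure_withDensity_ofReal h2.2
    have hchar : ∀ t : ℝ, charFun ν t = -iteratedDeriv 2 E t := by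
      intro t
      rw [← iteratedDeriv_comp_ofReal hE, ← funext h, iteratedDeriv_charFun hmem,
        charFun_apply_real, hν, integral_withDensity_eq_integral_smul hmeas]
      simp only [Complex.I_sq, neg_mul, one_mul, neg_neg]
      refine integral_congr_ae (Eventually.of_forall fun x => ?_)
      simp [NNReal.smul_def, Real.coe_toNNReal _ (sq_nonneg x)]
    have h3 := ih ν (E := fun z => -iteratedDeriv 2 E z) (hE.iteratedDeriv_complex 2).neg hchar
    rw [hν, integrable_withDensity_iff_integrable_smul hmeas] at h3
    refine h3.congr (Eventually.of_forall fun x => ?_)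
    simp only [NNReal.smul_def, Real.coe_toNNReal _ (sq_nonneg x), smul_eq_mul]
    ring

theorem hasSum_moment_of_charFun_eq_entire (μ : Measure ℝ) [IsFiniteMeasure μ] {E : ℂ → ℂ}
    (hE : Differentiable ℂ E) (h : ∀ t : ℝ, charFun μ t = E t) (t : ℝ) :
    HasSum (fun k : ℕ => Complex.I ^ k * ((∫ x, x ^ k ∂μ : ℝ) : ℂ) / k.factorial * (t : ℂ) ^ k)
      (charFun μ t) := by
  have hmem : ∀ k : ℕ, MemLp id k μ := by
    intro k
    -- An even, nonzero exponent that dominates `k`.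
    have h1 : MemLp id ((2 * (k + 1) : ℕ) : ENNReal) μ := by
      rw [← integrable_norm_rpow_iff (by fun_prop) (by exact_mod_cast (by omega : 2 * (k + 1) ≠ 0))
        (ENNReal.natCast_ne_top _)]
      refine (integrable_pow_of_charFun_eq_entire (k + 1) μ hE h).congr
        (Eventually.of_forall fun x => ?_)
      simp only [id, ENNReal.toReal_natCast, Real.rpow_natCast, Real.norm_eq_abs,
        (even_two_mul (k + 1)).pow_abs]
    exact h1.mono_exponent (by exact_mod_cast (by omega))
  rw [h t]
  convert! hE.hasSum_iteratedDeriv t using 2 with k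
  rw [← iteratedDeriv_charFun_zero (hmem k), ← Complex.ofReal_zero, ← iteratedDeriv_comp_ofReal hE,
    funext h]

/-- The even part of a power series at a point where the sum is even. -/
theorem hasSum_even_of_hasSum {c : ℕ → ℂ} {z s : ℂ} (h1 : HasSum (fun k => c k * z ^ k) s)
    (h2 : HasSum (fun k => c k * (-z) ^ k) s) :
    HasSum (fun k => c (2 * k) * z ^ (2 * k)) s := by
  have h3 := (h1.add h2).div_const 2
  rw [add_self_div_two] at h3
  have hinj : Function.Injective fun k : ℕ => 2 * k := fun a b hab => by
    simpa using hab
  rw [← hinj.hasSum_iff] at h3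
  · refine h3.congr_fun fun k => ?_
    simp only [Function.comp_apply, (even_two_mul k).neg_pow]
    ring
  · intro k hk
    have : Odd k := by
      rw [← Nat.not_even_iff_odd]
      rintro hk'
      obtain ⟨m, hm⟩ := hk'.two_dvd
      exact hk ⟨m, hm.symm⟩
    rw [this.neg_pow]
    ring

/-! ### Laguerre's theorem for `LP₊` and the two claims -/

theorem ne_zero_of_mem_laguerrePolyaPlus {φ : ℂ → ℂ} (hφ : φ ∈ laguerrePolyaPlus) : φ 0 ≠ 0 := by
  intro h
  obtain ⟨x, hx, hx0⟩ := hφ.2.1 0 h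
  exact hx.ne (by exact_mod_cast hx0.symm)

/-- The partial products are the multipliers. The geometric bound, from `(1 + x) * exp (-x) ≤ 1` for
`x ≥ 0`, keeps the new series entire. The claims use `s = 1` and `s = 1 / 2`. -/
theorem exists_multiplier_of_mem_laguerrePolyaPlus {φ : ℂ → ℂ} (hφ : φ ∈ laguerrePolyaPlus)
    {s : ℝ} (hs : 0 ≤ s) : ∃ Γ : ℕ → ℕ → ℂ, (∀ N, IsMultiplier (Γ N)) ∧
      (∀ k : ℕ, Tendsto (fun N => Γ N k) atTop (𝓝 (φ (s * k)))) ∧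
      ∃ K r : ℝ, ∀ k : ℕ, ‖φ (s * k)‖ ≤ K * r ^ k := by
  have h0 := ne_zero_of_mem_laguerrePolyaPlus hφ
  obtain ⟨-, -, K, a, w, hw, -, hlim⟩ := hφ
  have hK : K ≠ 0 := by
    rintro rfl
    exact h0 (tendsto_nhds_unique (hlim 0) (by simp))
  refine ⟨fun N k => (K : ℂ) * Complex.exp ((a * s : ℝ) * k) *
      ∏ j ∈ Finset.range N, (1 + ((w j * s : ℝ) : ℂ) * k) * Complex.exp (-((w j * s : ℝ) * k)),
    fun N => isMultiplier_laguerre hK _ (fun k => mul_nonneg (hw k) hs) N, fun k => ?_,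
    |K|, Real.exp (a * s), fun k => ?_⟩
  · simpa [mul_assoc] using hlim (s * k)
  · refine le_of_tendsto (hlim (s * k)).norm (Eventually.of_forall fun N => ?_)
    rw [norm_mul, norm_mul, Complex.norm_real, Real.norm_eq_abs, norm_prod]
    have h1 : ‖Complex.exp (a * (s * k))‖ = Real.exp (a * s) ^ k := by
      rw [← Real.exp_nat_mul, Complex.norm_exp]
      congr 1
      have : (a : ℂ) * (s * k) = ((k * (a * s) : ℝ) : ℂ) := by push_cast; ring
      rw [this, Complex.ofReal_re]
    rw [h1]
    refine mul_le_of_le_one_right (by positivity) (Finset.prod_le_one (fun _ _ => norm_nonneg _) ?_)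
    intro j _
    have hx : 0 ≤ w j * (s * k) := mul_nonneg (hw j) (by positivity)
    have h2 : (1 + w j * ((s : ℂ) * k)) * Complex.exp (-(w j * (s * k))) =
        (((1 + w j * (s * k)) * Real.exp (-(w j * (s * k))) : ℝ) : ℂ) := by push_cast; rfl
    rw [h2, Complex.norm_real, Real.norm_of_nonneg (by positivity), Real.exp_neg,
      ← div_eq_mul_inv, div_le_one (Real.exp_pos _)]
    linarith [Real.add_one_le_exp (w j * (s * k))]

theorem summable_norm_mul_of_le_geometric {a γ : ℕ → ℂ} {φ : ℂ → ℂ}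
    (ha : ∀ z, HasSum (fun n => a n * z ^ n) (φ z)) {K r : ℝ} (hγ : ∀ k, ‖γ k‖ ≤ K * r ^ k)
    (z : ℂ) : Summable fun n => ‖a n * γ n * z ^ n‖ := by
  refine Summable.of_nonneg_of_le (fun _ => norm_nonneg _) (fun n => ?_)
    (((ha (r * z)).summable.norm).mul_left |K|)
  rw [norm_mul, norm_mul, norm_mul, mul_pow, norm_mul, norm_pow, norm_pow, Complex.norm_real,
    Real.norm_eq_abs]
  calc ‖a n‖ * ‖γ n‖ * ‖z‖ ^ n ≤ ‖a n‖ * (|K| * |r| ^ n) * ‖z‖ ^ n := by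
        gcongr
        refine (hγ n).trans ((le_abs_self _).trans ?_)
        rw [abs_mul, abs_pow]
    _ = |K| * (‖a n‖ * (|r| ^ n * ‖z‖ ^ n)) := by ring

theorem moment_eq_integral_map {Ω : Type*} [MeasurableSpace Ω] {P : Measure Ω} {I : Ω → ℝ}
    (hI : AEMeasurable I P) (n : ℕ) : ∫ x, x ^ n ∂(P.map I) = moment I n P := by
  rw [integral_map hI (by fun_prop)]
  rfl

theorem moment_even_nonneg {Ω : Type*} [MeasurableSpace Ω] (P : Measure Ω) (I : Ω → ℝ) (n : ℕ) :
    0 ≤ moment I (2 * n) P :=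
  integral_nonneg fun _ => (even_two_mul n).pow_nonneg _

theorem moment_zero_eq_one {Ω : Type*} [MeasurableSpace Ω] (P : Measure Ω) [IsProbabilityMeasure P]
    (I : Ω → ℝ) : moment I 0 P = 1 := by
  simp [moment]

theorem hasSum_markovMul_map {Ω : Type*} [MeasurableSpace Ω] (P : Measure Ω) {I : Ω → ℝ}
    (hI : AEMeasurable I P) (hmom : ∀ n : ℕ, Integrable (fun ω => I ω ^ (2 * n)) P)
    {c : ℕ → ℂ} {f : ℝ → ℂ} (hf : ∀ x : ℝ, HasSum (fun n => c n * (x : ℂ) ^ (2 * n)) (f x)) (t : ℝ)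
    (hs : Summable fun n => ‖c n * (moment I (2 * n) P : ℂ) * (t : ℂ) ^ (2 * n)‖) :
    HasSum (fun n => c n * (moment I (2 * n) P : ℂ) * (t : ℂ) ^ (2 * n))
      (markovMul (P.map I) f t) := by
  have hint : ∀ n : ℕ, Integrable (fun x : ℝ => x ^ (2 * n)) (P.map I) := fun n =>
    (integrable_map_measure (by fun_prop) hI).2 (hmom n)
  have h := hasSum_markovMul (P.map I) hf hint t
  simp only [moment_eq_integral_map hI] at h
  refine h (hs.congr fun n => ?_)
  rw [norm_mul, norm_mul, ← Complex.ofReal_pow, Complex.norm_real, Complex.norm_real,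
    Real.norm_of_nonneg (moment_even_nonneg P I n),
    Real.norm_of_nonneg ((even_two_mul n).pow_nonneg t)]

theorem hasSum_even_moment_of_charFun {Ω : Type*} [MeasurableSpace Ω] (P : Measure Ω)
    [IsProbabilityMeasure P] {D : Ω → ℝ} (hD : AEMeasurable D P) {F : ℝ → ℂ}
    (hF : ∀ t, charFun (P.map D) t = F t) {E : ℂ → ℂ} (hE : Differentiable ℂ E)
    (hFE : ∀ t : ℝ, F t = E t) (heven : ∀ t, F (-t) = F t) (t : ℝ) :
    HasSum (fun n : ℕ => (((-1) ^ n * moment D (2 * n) P / (2 * n).factorial : ℝ) : ℂ) *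
      (t : ℂ) ^ (2 * n)) (F t) := by
  have : IsProbabilityMeasure (P.map D) := Measure.isProbabilityMeasure_map hD
  have h := hasSum_moment_of_charFun_eq_entire (P.map D) hE fun t => (hF t).trans (hFE t)
  have h2 := h (-t)
  rw [hF, heven, Complex.ofReal_neg] at h2
  have h1 := h t
  rw [hF] at h1
  refine (hasSum_even_of_hasSum h1 h2).congr_fun fun n => ?_
  rw [moment_eq_integral_map hD, pow_mul Complex.I, Complex.I_sq]
  push_cast
  rfl

theorem markovMul_mem_lukacsClass_of_charFun {Ω Ω' : Type*} [MeasurableSpace Ω] (P : Measure Ω)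
    [IsProbabilityMeasure P] {I : Ω → ℝ} (hI : AEMeasurable I P)
    (hmom : ∀ n : ℕ, Integrable (fun ω => I ω ^ (2 * n)) P) [MeasurableSpace Ω'] (P' : Measure Ω')
    [IsProbabilityMeasure P'] {D : Ω' → ℝ} (hD : AEMeasurable D P') {F : ℝ → ℂ}
    (hFpos : F ∈ posDefNormalized) (hF : ∀ t, charFun (P'.map D) t = F t) {E : ℂ → ℂ}
    (hE : Differentiable ℂ E) (hFE : ∀ t : ℝ, F t = E t) (heven : ∀ t, F (-t) = F t)
    {φ G : ℂ → ℂ} (hφ : φ ∈ laguerrePolya) (hG : G ∈ laguerrePolyaPlus) {a : ℕ → ℝ}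
    (ha : ∀ z : ℂ, HasSum (fun n => (a n : ℂ) * z ^ n) (φ z))
    (h : ∀ n : ℕ, ((moment I (2 * n) P * moment D (2 * n) P' : ℝ) : ℂ) =
      a n * G n * (2 * n).factorial) : markovMul (P.map I) F ∈ lukacsClass := by
  have : IsProbabilityMeasure (P.map I) := Measure.isProbabilityMeasure_map hI
  refine ⟨markovMul_mem_posDefNormalized _ hFpos, ?_⟩
  obtain ⟨Γ, hΓ, hlim, K, r, hbound⟩ := exists_multiplier_of_mem_laguerrePolyaPlus hG zero_le_one
  simp only [Complex.ofReal_one, one_mul] at hlim hbound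
  -- Written through moments, `b` is visibly nonnegative, as the substitution `-z ^ 2` requires.
  set b : ℕ → ℝ := fun n =>
    moment I (2 * n) P * moment D (2 * n) P' / (2 * n).factorial with hb
  have hbG : ∀ n, (b n : ℂ) = a n * G n := fun n => by
    have hfac : ((2 * n).factorial : ℂ) ≠ 0 := Nat.cast_ne_zero.2 (Nat.factorial_ne_zero _)
    rw [hb, Complex.ofReal_div, h n, Complex.ofReal_natCast, mul_div_cancel_right₀ _ hfac]
  have hsum : ∀ z, Summable fun n => ‖(b n : ℂ) * z ^ n‖ := fun z => by
    simpa only [hbG] using summable_norm_mul_of_le_geometric ha hbound z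
  have hΦ : ∀ z, HasSum (fun n => (b n : ℂ) * z ^ n) (∑' n, (b n : ℂ) * z ^ n) := fun z =>
    (hsum z).of_norm.hasSum
  have hb0 : b 0 = 1 := by simp [hb, moment_zero_eq_one]
  have hbnonneg : ∀ n, 0 ≤ b n := fun n =>
    div_nonneg (mul_nonneg (moment_even_nonneg _ _ _) (moment_even_nonneg _ _ _)) (by positivity)
  have hterm : ∀ (n : ℕ) (t : ℝ), (b n : ℂ) * (-(t : ℂ) ^ 2) ^ n =
      (((-1) ^ n * moment D (2 * n) P' / (2 * n).factorial : ℝ) : ℂ) *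
        (moment I (2 * n) P : ℂ) * (t : ℂ) ^ (2 * n) := fun n t => by
    rw [neg_pow, ← pow_mul, hb]
    push_cast
    ring
  refine ⟨fun z => ∑' n, (b n : ℂ) * (-z ^ 2) ^ n,
    ⟨comp_neg_sq_mem_laguerrePolya hΦ (by simp [hb0]) hbnonneg fun n hn => ?_, fun z => by simp, ?_⟩,
    fun t => ?_⟩
  · simp only [hbG]
    exact hyperbolic_jensen_mul hφ ha hΓ hlim hn
  · beta_reduce
    rw [tsum_eq_single 0 fun n hn => by simp [hn]]
    simp [hb0]
  · have h1 := hasSum_markovMul_map P hI hmom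
      (hasSum_even_moment_of_charFun P' hD hF hE hFE heven) t
      ((hsum (-(t : ℂ) ^ 2)).congr fun n => by rw [hterm])
    simp only [← hterm] at h1
    exact h1.tsum_eq.symm

/-- The multiplier acts on the full series of `ψ` in `z`, not on a series in `z ^ 2`, so no sign
condition on coefficients is needed. -/
theorem markovMul_mem_lukacsClass {Ω : Type*} [MeasurableSpace Ω] (P : Measure Ω)
    [IsProbabilityMeasure P] {I : Ω → ℝ} (hI : AEMeasurable I P)
    (hmom : ∀ n : ℕ, Integrable (fun ω => I ω ^ (2 * n)) P) {φ : ℂ → ℂ}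
    (hφ : φ ∈ laguerrePolyaPlus) (h : ∀ n : ℕ, φ n = (moment I (2 * n) P : ℂ)) {f : ℝ → ℂ}
    (hf : f ∈ lukacsClass) : markovMul (P.map I) f ∈ lukacsClass := by
  have : IsProbabilityMeasure (P.map I) := Measure.isProbabilityMeasure_map hI
  obtain ⟨hpos, ψ, ⟨hψ, heven, hψ0⟩, hfψ⟩ := hf
  refine ⟨markovMul_mem_posDefNormalized _ hpos, ?_⟩
  obtain ⟨Γ, hΓ, hlim, K, r, hbound⟩ :=
    exists_multiplier_of_mem_laguerrePolyaPlus hφ (s := 1 / 2) (by norm_num)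
  obtain ⟨c, hc⟩ := exists_real_coeff_of_mem_laguerrePolya hψ
  have hc2 : ∀ z, HasSum (fun n => (c (2 * n) : ℂ) * z ^ (2 * n)) (ψ z) := fun z =>
    hasSum_even_of_hasSum (c := fun n => (c n : ℂ)) (hc z) (heven z ▸ hc (-z))
  have hinj : Function.Injective fun k : ℕ => 2 * k := fun a b hab => by simpa using hab
  have hodd : ∀ k ∉ Set.range (fun k : ℕ => 2 * k), ¬ Even k := fun k hk hk' => by
    obtain ⟨m, hm⟩ := hk'.two_dvd
    exact hk ⟨m, hm.symm⟩
  -- With odd coefficients set to zero, the values of `φ` at half-integers, unrelated to the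
  -- moments, play no role.
  set c' : ℕ → ℂ := fun n => if Even n then c n else 0 with hc'
  have hsumc' : ∀ z, HasSum (fun n => c' n * z ^ n) (ψ z) := fun z => by
    rw [← hinj.hasSum_iff fun k hk => by simp [hc', hodd k hk]]
    simpa [Function.comp_def, hc'] using hc2 z
  set b : ℕ → ℝ := fun n => if Even n then c n * moment I n P else 0 with hb
  have hbφ : ∀ n : ℕ, (b n : ℂ) = c' n * φ ((1 / 2 : ℝ) * n) := fun n => by
    by_cases hn : Even n
    · obtain ⟨m, rfl⟩ := hn.two_dvd
      have : (((1 / 2 : ℝ) : ℂ) * ((2 * m : ℕ) : ℂ)) = m := by push_cast; ring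
      rw [this, h]
      simp [hb, hc']
    · simp [hb, hc', hn]
  have hsum : ∀ z, Summable fun n => ‖(b n : ℂ) * z ^ n‖ := fun z => by
    simpa only [hbφ] using summable_norm_mul_of_le_geometric hsumc' hbound z
  have hg : ∀ z, HasSum (fun n => (b n : ℂ) * z ^ n) (∑' n, (b n : ℂ) * z ^ n) := fun z =>
    (hsum z).of_norm.hasSum
  have hc0 : c 0 = 1 := by
    have h1 := (hc 0).unique (hasSum_single 0 fun n hn => by simp [hn])
    simpa [hψ0] using h1.symm
  have hb0 : b 0 = 1 := by simp [hb, moment_zero_eq_one, hc0]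
  refine ⟨fun z => ∑' n, (b n : ℂ) * z ^ n,
    ⟨mem_laguerrePolya_of_hyperbolic_jensen hg (by simp [hb0]) fun n hn => ?_, fun z => ?_, ?_⟩,
    fun t => ?_⟩
  · simp only [hbφ]
    exact hyperbolic_jensen_mul hψ hsumc' hΓ hlim hn
  · refine tsum_congr fun n => ?_
    by_cases hn : Even n
    · rw [hn.neg_pow]
    · simp [hb, hn]
  · beta_reduce
    rw [tsum_eq_single 0 fun n hn => by simp [hn]]
    simp [hb0]
  · have hterm : ∀ n : ℕ, (b (2 * n) : ℂ) * (t : ℂ) ^ (2 * n) =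
        c (2 * n) * (moment I (2 * n) P : ℂ) * (t : ℂ) ^ (2 * n) := fun n => by simp [hb]
    have h1 := hasSum_markovMul_map P hI hmom (c := fun n => (c (2 * n) : ℂ)) (f := f)
      (fun x => by rw [hfψ x]; exact hc2 x) t
      (((hsum t).comp_injective hinj).congr fun n => by rw [← hterm, Function.comp_apply])
    have h2 := hg t
    rw [← hinj.hasSum_iff fun k hk => by simp [hb, hodd k hk]] at h2
    exact h1.unique (h2.congr_fun fun n => (hterm n).symm)

theorem mainTheorem3 {Ω : Type*} [MeasurableSpace Ω] (P : Measure Ω) [IsProbabilityMeasure P]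
    (I : Ω → ℝ) (hI : AEMeasurable I P)
    (hI_moments : ∀ n : ℕ, Integrable (fun ω => I ω ^ (2 * n)) P) :
    (∀ {Ω' : Type*} [MeasurableSpace Ω'] (P' : Measure Ω') [IsProbabilityMeasure P']
      (D : Ω' → ℝ) (_ : AEMeasurable D P') (F : ℝ → ℂ),
      F ∈ posDefNormalized →
      (∀ t, charFun (P'.map D) t = F t) →
      (∃ E : ℂ → ℂ, Differentiable ℂ E ∧ ∀ t : ℝ, F t = E t) →
      (∀ t, F (-t) = F t) →
      ∀ φ ∈ laguerrePolya, ∀ G ∈ laguerrePolyaPlus, ∀ a : ℕ → ℝ,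
      (∀ z : ℂ, HasSum (fun n => (a n : ℂ) * z ^ n) (φ z)) →
      (∀ n : ℕ, ((moment I (2 * n) P * moment D (2 * n) P' : ℝ) : ℂ) =
        a n * G n * (2 * n).factorial) →
      markovMul (P.map I) F ∈ lukacsClass) ∧
    (∀ φ ∈ laguerrePolyaPlus,
      (∀ n : ℕ, φ n = (moment I (2 * n) P : ℂ)) →
      markovMul (P.map I) '' lukacsClass ⊆ lukacsClass) := by
  refine ⟨fun {Ω'} _ P' _ D hD F hFpos hF hE heven φ hφ G hG a ha h => ?_, fun φ hφ h => ?_⟩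
  · obtain ⟨E, hEd, hFE⟩ := hE
    exact markovMul_mem_lukacsClass_of_charFun P hI hI_moments P' hD hFpos hF hEd hFE heven hφ hG
      ha h
  · rintro _ ⟨f, hf, rfl⟩
    exact markovMul_mem_lukacsClass P hI hI_moments hφ h hf
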